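/- **Theorem (Optimal critic gradient).** Let $n\in\mathbb N$ and let $p_r,p_\theta$ be Borel probability measures on $\mathbb R^n$ with finite first moments, $\int\|x\|_2\,dp_r(x)<\infty$ and $\int\|x\|_2\,dp_\theta(x)<\infty$. Let $f^*:\mathbb R^n\to\mathbb R$ be an optimal critic, i.e. a 1-Lipschitz function (for the Euclidean norm) that maximises the Kantorovich–Rubinstein dual objective $$f\longmapsto \mathbb E_{x\sim p_r}f(x)-\mathbb E_{y\sim p_\theta}f(y)$$ among all 1-Lipschitz functions $f:\mathbb R^n\to\mathbb R$. Let $\gamma^*$ be an optimal transport plan, i.e. a minimiser of $\mathbb E_{(x,y)\sim\gamma}\|x-y\|_2$ among all joint distributions $\gamma$ on $\mathbb R^n\times\mathbb R^n$ with marginals $p_r$ and $p_\theta$. Then $\|\nabla f^*\|_2=1$ almost everywhere along the transport segments, in the following sense. 1. For $\gamma^*$-almost every $(x,y)$ with $x\neq y$, writing $x_t=(1-t)x+ty$: for every $t\in(0,1)$ the function $f^*$ is differentiable at $x_t$ and $\|\nabla f^*(x_t)\|_2=1$; and for every $t\in[0,1]$ (endpoints included) such that $f^*$ is differentiable at $x_t$,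 $\|\nabla f^*(x_t)\|_2=1$. 2. If moreover $\gamma^*(\{(x,y):x=y\})=0$, then $\|\nabla f^*(x)\|_2=1$ for $p_r$-almost every $x$ at which $f^*$ is differentiable, and for $p_\theta$-almost every $x$ at which $f^*$ is differentiable. In particular, if $f^*$ is differentiable, then $\|\nabla f^*\|_2=1$ holds $p_r$-almost everywhere and $p_\theta$-almost everywhere. -/

import Mathlib

open MeasureTheory

/-- Transport plans between `p` and `q`: joint distributions with marginals `p` and `q`. -/
def transportPlans {n : ℕ} (p q : Measure (EuclideanSpace ℝ (Fin n))) :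
    Set (Measure (EuclideanSpace ℝ (Fin n) × EuclideanSpace ℝ (Fin n))) :=
  {γ | γ.fst = p ∧ γ.snd = q}

/-- The expected Euclidean distance `E_{(x, y) ∼ γ} ‖x - y‖₂`, as an element of `[0, ∞]`. -/
noncomputable def transportCost {n : ℕ}
    (γ : Measure (EuclideanSpace ℝ (Fin n) × EuclideanSpace ℝ (Fin n))) : ENNReal :=
  ∫⁻ z, ‖z.1 - z.2‖ₑ ∂γ

/-- `γ` is an optimal transport plan: it attains `inf_{γ ∈ Π(p, q)} E_{(x, y) ∼ γ} ‖x - y‖₂`. -/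
def IsOptimalPlan {n : ℕ} (p q : Measure (EuclideanSpace ℝ (Fin n)))
    (γ : Measure (EuclideanSpace ℝ (Fin n) × EuclideanSpace ℝ (Fin n))) : Prop :=
  γ ∈ transportPlans p q ∧ IsMinOn transportCost (transportPlans p q) γ

/-- The Kantorovich-Rubinstein dual objective `E_{x ∼ p} f(x) - E_{y ∼ q} f(y)`. It is only used
for `p`, `q` with finite first moment and Lipschitz `f`, where both integrals converge. -/
noncomputable def dualObjective {n : ℕ} (p q : Measure (EuclideanSpace ℝ (Fin n)))
    (f : EuclideanSpace ℝ (Fin n) → ℝ) : ℝ :=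
  (∫ x, f x ∂p) - ∫ y, f y ∂q

/-- `f` is an optimal critic: a 1-Lipschitz function (for the Euclidean norm) that maximises the
dual objective among all 1-Lipschitz functions. -/
def IsOptimalCritic {n : ℕ} (p q : Measure (EuclideanSpace ℝ (Fin n)))
    (f : EuclideanSpace ℝ (Fin n) → ℝ) : Prop :=
  LipschitzWith 1 f ∧ IsMaxOn (dualObjective p q) {g | LipschitzWith 1 g} f

/-!
Optimality of `γ` and of `f` combine, through Kantorovich–Rubinstein duality, to the complementary
slackness relation `f x - f y = ‖x - y‖` for `γ`-almost every `(x, y)`. The part of the duality that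
is needed, the existence of a `1`-Lipschitz `g` attaining the transport cost of `γ`, is obtained by
the classical cyclical monotonicity argument.

* `IsOptimalPlan.sum_dist_le`: permuting the endpoints of finitely many points of the support of
  `γ` cannot lower their total transport cost. Otherwise a small amount of mass near these points
  could be rerouted along the permutation, with a strictly cheaper plan as a result.
* `exists_lipschitz_of_cyclicallyMonotone`: Rockafellar's construction. The infimum, over chains of
  points of the support, of the cost of the chain is `1`-Lipschitz and satisfies `g x - g y = ‖x - y‖`
  on the support.

Once `f x - f y = ‖x - y‖` with `x ≠ y`, the Lipschitz bound forces `f` to decrease with unit speed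
along the segment from `x` to `y`. At an interior point `f` is squeezed between `f x - ‖x - ·‖` and
`f y + ‖· - y‖`, which are differentiable there and agree at that point, so `f` is differentiable too.
Wherever `f` is differentiable on the closed segment, the derivative in a unit direction has absolute
value `1`, which together with the Lipschitz bound gives a gradient of norm `1`.
-/

/-! ### Rockafellar's potential -/

/-- The cost of reaching `x` along the chain `z 0, …, z k` of pairs: a step from the pair `z i` to the
pair `z (i + 1)` costs `d((z (i + 1)).1, (z i).2) - d((z i).1, (z i).2)`, and the step from the last
pair to `x` is charged likewise. -/
noncomputable def chainCost {E : Type*} [PseudoMetricSpace E] (z : ℕ → E × E) (k : ℕ) (x : E) : ℝ :=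
  dist x (z k).2 + ∑ i ∈ Finset.range k, dist (z (i + 1)).1 (z i).2
    - ∑ i ∈ Finset.range (k + 1), dist (z i).1 (z i).2

/-- A set of pairs is cyclically monotone for the metric cost if no permutation of the second
components of finitely many of its elements lowers their total cost. The permutation is applied to
the first components, which is the same up to reindexing. -/
def CyclicallyMonotone {E : Type*} [PseudoMetricSpace E] (S : Set (E × E)) : Prop :=
  ∀ (k : ℕ) (z : Fin k → E × E) (σ : Equiv.Perm (Fin k)), (∀ i, z i ∈ S) →
    ∑ i, dist (z i).1 (z i).2 ≤ ∑ i, dist (z (σ i)).1 (z i).2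

theorem chainCost_le_add_dist {E : Type*} [PseudoMetricSpace E] (z : ℕ → E × E) (k : ℕ) (x y : E) :
    chainCost z k x ≤ chainCost z k y + dist x y := by
  have := dist_triangle x y (z k).2
  unfold chainCost
  linarith

/-- A chain closing up at its starting point has nonnegative cost: this is cyclical monotonicity
for the cyclic permutation. -/
theorem CyclicallyMonotone.chainCost_nonneg {E : Type*} [PseudoMetricSpace E] {S : Set (E × E)}
    (hS : CyclicallyMonotone S) {z : ℕ → E × E} (hz : ∀ i, z i ∈ S) (k : ℕ) :
    0 ≤ chainCost z k (z 0).1 := by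
  have h := hS (k + 1) (fun i => z i) (finRotate (k + 1)) (fun i => hz i)
  rw [Fin.sum_univ_eq_sum_range (fun i => dist (z i).1 (z i).2)] at h
  rw [Fin.sum_univ_castSucc] at h
  have hrot : ∀ i : Fin k, ((finRotate (k + 1) i.castSucc : Fin (k + 1)) : ℕ) = i + 1 := by
    intro i
    rw [finRotate_apply, Fin.coeSucc_eq_succ, Fin.val_succ]
  simp only [hrot, finRotate_last, Fin.val_zero, Fin.val_last, Fin.val_castSucc] at h
  rw [Fin.sum_univ_eq_sum_range (fun i => dist (z (i + 1)).1 (z i).2)] at h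
  unfold chainCost
  linarith

theorem exists_lipschitz_of_cyclicallyMonotone {E : Type*} [PseudoMetricSpace E] {S : Set (E × E)}
    (hS : CyclicallyMonotone S) :
    ∃ g : E → ℝ, LipschitzWith 1 g ∧ ∀ z ∈ S, g z.1 - g z.2 = dist z.1 z.2 := by
  rcases S.eq_empty_or_nonempty with rfl | ⟨z₀, hz₀⟩
  · exact ⟨fun _ => 0, LipschitzWith.const' 0, by simp⟩
  let I := {z : ℕ → E × E // z 0 = z₀ ∧ ∀ i, z i ∈ S} × ℕ
  have : Nonempty I := ⟨⟨⟨fun _ => z₀, rfl, fun _ => hz₀⟩, 0⟩⟩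
  let c : I → E → ℝ := fun p => chainCost p.1.1 p.2
  have hbdd : ∀ x, BddBelow (Set.range fun p : I => c p x) := by
    intro x
    refine ⟨-dist z₀.1 x, ?_⟩
    rintro _ ⟨p, rfl⟩
    have h0 := hS.chainCost_nonneg p.1.2.2 p.2
    rw [p.1.2.1] at h0
    have h1 := chainCost_le_add_dist p.1.1 p.2 z₀.1 x
    simp only [c]
    linarith
  let g : E → ℝ := fun x => ⨅ p : I, c p x
  have hlip : LipschitzWith 1 g := by
    refine LipschitzWith.of_le_add fun x y => ?_
    rw [← sub_le_iff_le_add]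
    refine le_ciInf fun p => ?_
    rw [sub_le_iff_le_add]
    exact (ciInf_le (hbdd x) p).trans (chainCost_le_add_dist _ _ _ _)
  refine ⟨g, hlip, fun w hw => le_antisymm ?_ ?_⟩
  · have := hlip.dist_le_mul w.1 w.2
    rw [NNReal.coe_one, one_mul, Real.dist_eq] at this
    exact (le_abs_self _).trans this
  · -- Appending `w` to a chain that reaches `w.1` gives a chain that reaches `w.2`.
    rw [le_sub_comm, le_sub_iff_add_le]
    refine le_ciInf fun p => ?_
    obtain ⟨⟨z, h0, hz⟩, k⟩ := p
    have hle := ciInf_le (hbdd w.2) (⟨⟨Function.update z (k + 1) w, by simp [Function.update, h0],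
      fun i => by by_cases h : i = k + 1 <;> simp [Function.update, h, hw, hz]⟩, k + 1⟩ : I)
    have hcost : chainCost (Function.update z (k + 1) w) (k + 1) w.2
        = chainCost z k w.1 - dist w.1 w.2 := by
      have e1 : ∀ i ∈ Finset.range k, dist (Function.update z (k + 1) w (i + 1)).1
          (Function.update z (k + 1) w i).2 = dist (z (i + 1)).1 (z i).2 := by
        intro i hi
        have := Finset.mem_range.1 hi
        rw [Function.update_of_ne (by omega), Function.update_of_ne (by omega)]
      have e2 : ∀ i ∈ Finset.range (k + 1), dist (Function.update z (k + 1) w i).1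
          (Function.update z (k + 1) w i).2 = dist (z i).1 (z i).2 := by
        intro i hi
        have := Finset.mem_range.1 hi
        rw [Function.update_of_ne (by omega)]
      unfold chainCost
      rw [Finset.sum_range_succ _ k, Finset.sum_congr rfl e1, Finset.sum_range_succ _ (k + 1),
        Finset.sum_congr rfl e2, Function.update_self, Function.update_of_ne (by omega)]
      simp
      ring
    have hle' : g w.2 ≤ chainCost z k w.1 - dist w.1 w.2 := hle.trans_eq hcost
    simp only [c]
    linarith

/-! ### Cyclical monotonicity of the support of an optimal plan -/

section Plans

variable {n : ℕ} {p q : Measure (EuclideanSpace ℝ (Fin n))}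
  {γ : Measure (EuclideanSpace ℝ (Fin n) × EuclideanSpace ℝ (Fin n))}

theorem integrable_comp_fst_of_mem_transportPlans (hγ : γ ∈ transportPlans p q)
    {g : EuclideanSpace ℝ (Fin n) → ℝ} (hg : Integrable g p) : Integrable (fun z => g z.1) γ := by
  rw [← hγ.1] at hg
  exact hg.comp_measurable measurable_fst

theorem integrable_comp_snd_of_mem_transportPlans (hγ : γ ∈ transportPlans p q)
    {g : EuclideanSpace ℝ (Fin n) → ℝ} (hg : Integrable g q) : Integrable (fun z => g z.2) γ := by
  rw [← hγ.2] at hg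
  exact hg.comp_measurable measurable_snd

theorem isProbabilityMeasure_of_mem_transportPlans [IsProbabilityMeasure p]
    (hγ : γ ∈ transportPlans p q) : IsProbabilityMeasure γ :=
  ⟨by rw [← Measure.fst_univ, hγ.1, measure_univ]⟩

theorem integrable_norm_sub_of_mem_transportPlans (hp : Integrable (fun x => ‖x‖) p)
    (hq : Integrable (fun x => ‖x‖) q) (hγ : γ ∈ transportPlans p q) :
    Integrable (fun z => ‖z.1 - z.2‖) γ := by
  refine ((integrable_comp_fst_of_mem_transportPlans hγ hp).add
    (integrable_comp_snd_of_mem_transportPlans hγ hq)).mono'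
    (measurable_fst.sub measurable_snd).norm.aestronglyMeasurable (.of_forall fun z => ?_)
  simpa using norm_sub_le z.1 z.2

theorem transportCost_ne_top (hp : Integrable (fun x => ‖x‖) p)
    (hq : Integrable (fun x => ‖x‖) q) (hγ : γ ∈ transportPlans p q) : transportCost γ ≠ ⊤ := by
  have h := (integrable_norm_sub_of_mem_transportPlans hp hq hγ).2
  simpa [transportCost, HasFiniteIntegral] using h.ne

/-- Rerouting: probability measures `μ i`, a small multiple of whose sum is contained in `γ`, are
replaced in `γ` by the products of the first marginal of `μ (σ i)` with the second marginal of
`μ i`. The marginals of `γ` do not change, so optimality bounds the cost of the removed part. -/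
theorem IsOptimalPlan.sum_transportCost_le (hγ : IsOptimalPlan p q γ) (hfin : transportCost γ ≠ ⊤)
    {ι : Type*} [Fintype ι] (σ : Equiv.Perm ι)
    (μ : ι → Measure (EuclideanSpace ℝ (Fin n) × EuclideanSpace ℝ (Fin n)))
    [∀ i, IsProbabilityMeasure (μ i)] {ε : NNReal} (hε : ε ≠ 0) (hle : ε • ∑ i, μ i ≤ γ) :
    ∑ i, transportCost (μ i) ≤ ∑ i, transportCost ((μ (σ i)).fst.prod (μ i).snd) := by
  set ν := ε • ∑ i, μ i
  set ρ := fun i => (μ (σ i)).fst.prod (μ i).snd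
  have hsplit : γ - ν + ν = γ := Measure.sub_add_cancel_of_le hle
  have hfst : (ε • ∑ i, ρ i).fst = ν.fst := by
    ext s hs
    simp only [ν, Measure.fst_apply hs, Measure.smul_apply, Measure.finsetSum_apply]
    congr 1
    rw [← Equiv.sum_comp σ (fun i => μ i (Prod.fst ⁻¹' s))]
    refine Finset.sum_congr rfl fun i _ => ?_
    rw [← Measure.fst_apply hs, ← Measure.fst_apply hs, Measure.fst_prod]
  have hsnd : (ε • ∑ i, ρ i).snd = ν.snd := by
    ext s hs
    simp only [ν, Measure.snd_apply hs, Measure.smul_apply, Measure.finsetSum_apply]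
    congr 1
    refine Finset.sum_congr rfl fun i _ => ?_
    rw [← Measure.snd_apply hs, ← Measure.snd_apply hs, Measure.snd_prod]
  have hmem : γ - ν + ε • ∑ i, ρ i ∈ transportPlans p q := by
    constructor
    · rw [Measure.fst_add, hfst, ← Measure.fst_add, hsplit, hγ.1.1]
    · rw [Measure.snd_add, hsnd, ← Measure.snd_add, hsplit, hγ.1.2]
  have hcost : ∀ m : ι → Measure (EuclideanSpace ℝ (Fin n) × EuclideanSpace ℝ (Fin n)),
      transportCost (γ - ν + ε • ∑ i, m i)
        = transportCost (γ - ν) + ε * ∑ i, transportCost (m i) := by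
    intro m
    simp only [transportCost, lintegral_add_measure, lintegral_smul_measure,
      lintegral_finsetSum_measure]
    rfl
  have hopt : transportCost (γ - ν + ν) ≤ transportCost (γ - ν + ε • ∑ i, ρ i) := by
    rw [hsplit]
    exact hγ.2 hmem
  rw [hcost ρ, hcost μ] at hopt
  have hne : transportCost (γ - ν) ≠ ⊤ :=
    ne_top_of_le_ne_top hfin (lintegral_mono' Measure.sub_le le_rfl)
  rwa [ENNReal.add_le_add_iff_left hne,
    ENNReal.mul_le_mul_iff_right (by simpa using hε) ENNReal.coe_ne_top] at hopt

/-- Finitely many points of the support of an optimal plan satisfy the inequality of cyclical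
monotonicity: the rerouting inequality is applied to the normalised restrictions of `γ` to balls of
radius `δ` around these points, and `δ` tends to `0`. -/
theorem IsOptimalPlan.sum_dist_le [IsFiniteMeasure γ] (hγ : IsOptimalPlan p q γ)
    (hfin : transportCost γ ≠ ⊤) {ι : Type*} [Fintype ι] (σ : Equiv.Perm ι)
    (z : ι → EuclideanSpace ℝ (Fin n) × EuclideanSpace ℝ (Fin n)) (hz : ∀ i, z i ∈ γ.support) :
    ∑ i, dist (z i).1 (z i).2 ≤ ∑ i, dist (z (σ i)).1 (z i).2 := by
  rcases isEmpty_or_nonempty ι with hι | hι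
  · simp
  refine le_of_forall_pos_le_add fun η hη => ?_
  have hcard : (0 : ℝ) < Fintype.card ι := by exact_mod_cast Fintype.card_pos
  -- Each of the `2 * card ι` distances is perturbed by at most `2 * δ`.
  set δ : ℝ := η / (4 * Fintype.card ι) with hδ_def
  have hδ : 0 < δ := by positivity
  set W := fun i => Metric.ball (z i) δ
  have hW : ∀ i, γ (W i) ≠ 0 := fun i =>
    ((Measure.mem_support_iff_forall _).1 (hz i) _ (Metric.ball_mem_nhds _ hδ)).ne'
  set μ := fun i => ProbabilityTheory.cond γ (W i)
  have : ∀ i, IsProbabilityMeasure (μ i) := fun i =>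
    ProbabilityTheory.cond_isProbabilityMeasure (hW i)
  have hWμ : ∀ i, ∀ᵐ w ∂μ i, w ∈ W i := fun i =>
    ProbabilityTheory.ae_cond_mem Metric.isOpen_ball.measurableSet
  have hfstμ : ∀ i, ∀ᵐ x ∂(μ i).fst, dist x (z i).1 < δ := fun i => by
    rw [Measure.fst, ae_map_iff measurable_fst.aemeasurable
      (measurableSet_lt (by fun_prop) measurable_const)]
    filter_upwards [hWμ i] with w hw
    exact (max_lt_iff.1 hw).1
  have hsndμ : ∀ i, ∀ᵐ y ∂(μ i).snd, dist y (z i).2 < δ := fun i => by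
    rw [Measure.snd, ae_map_iff measurable_snd.aemeasurable
      (measurableSet_lt (by fun_prop) measurable_const)]
    filter_upwards [hWμ i] with w hw
    exact (max_lt_iff.1 hw).2
  obtain ⟨ε, hε, hle⟩ : ∃ ε : NNReal, ε ≠ 0 ∧ ε • ∑ i, μ i ≤ γ := by
    set C : ENNReal := ∑ i, (γ (W i))⁻¹
    have hC : C ≠ ⊤ := by simp [C, hW]
    have hC0 : C ≠ 0 := by simp [C]
    refine ⟨C⁻¹.toNNReal, ?_, ?_⟩
    · simp [ENNReal.toNNReal_eq_zero_iff, hC, hC0]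
    · refine Measure.le_iff'.2 fun s => ?_
      rw [Measure.smul_apply, Measure.finsetSum_apply, ENNReal.smul_def, smul_eq_mul,
        ENNReal.coe_toNNReal (by simpa using hC0)]
      calc C⁻¹ * ∑ i, μ i s ≤ C⁻¹ * ∑ i, (γ (W i))⁻¹ * γ s := by
            gcongr with i
            simp only [μ, ProbabilityTheory.cond, Measure.smul_apply, smul_eq_mul]
            gcongr
            exact Measure.restrict_le_self
        _ = γ s := by
            rw [← Finset.sum_mul, ← mul_assoc, ENNReal.inv_mul_cancel hC0 hC, one_mul]
  have hmain := hγ.sum_transportCost_le hfin σ μ hε hle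
  have hlow : ∀ i, ENNReal.ofReal (dist (z i).1 (z i).2 - 2 * δ) ≤ transportCost (μ i) := by
    intro i
    have : ENNReal.ofReal (dist (z i).1 (z i).2 - 2 * δ)
        = ∫⁻ _, ENNReal.ofReal (dist (z i).1 (z i).2 - 2 * δ) ∂μ i := by simp
    rw [this]
    refine lintegral_mono_ae ?_
    filter_upwards [hWμ i] with w hw
    rw [← ofReal_norm, ← dist_eq_norm]
    refine ENNReal.ofReal_le_ofReal ?_
    obtain ⟨h1, h2⟩ : dist w.1 (z i).1 < δ ∧ dist w.2 (z i).2 < δ := max_lt_iff.1 hw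
    have := dist_triangle4 (z i).1 w.1 w.2 (z i).2
    rw [dist_comm (z i).1 w.1] at this
    linarith
  have hupp : ∀ i, transportCost ((μ (σ i)).fst.prod (μ i).snd)
      ≤ ENNReal.ofReal (dist (z (σ i)).1 (z i).2 + 2 * δ) := by
    intro i
    have : ENNReal.ofReal (dist (z (σ i)).1 (z i).2 + 2 * δ)
        = ∫⁻ _, ENNReal.ofReal (dist (z (σ i)).1 (z i).2 + 2 * δ)
          ∂((μ (σ i)).fst.prod (μ i).snd) := by simp
    rw [this]
    refine lintegral_mono_ae ?_
    filter_upwards [Measure.quasiMeasurePreserving_fst.ae (hfstμ (σ i)),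
      Measure.quasiMeasurePreserving_snd.ae (hsndμ i)] with w h1 h2
    rw [← ofReal_norm, ← dist_eq_norm]
    refine ENNReal.ofReal_le_ofReal ?_
    have := dist_triangle4 w.1 (z (σ i)).1 (z i).2 w.2
    rw [dist_comm (z i).2 w.2] at this
    linarith
  -- The lower bounds `dist _ _ - 2 * δ` may be negative, which is harmless since `ENNReal.ofReal` is
  -- subadditive.
  have hreal : ∑ i, (dist (z i).1 (z i).2 - 2 * δ) ≤ ∑ i, (dist (z (σ i)).1 (z i).2 + 2 * δ) := by
    have hpos : ∀ i ∈ Finset.univ, 0 ≤ dist (z (σ i)).1 (z i).2 + 2 * δ := fun i _ => by positivity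
    rw [← ENNReal.ofReal_le_ofReal_iff (Finset.sum_nonneg hpos), ENNReal.ofReal_sum_of_nonneg hpos]
    calc _ ≤ ∑ i, ENNReal.ofReal (dist (z i).1 (z i).2 - 2 * δ) :=
          Finset.le_sum_of_subadditive _ ENNReal.ofReal_zero.le
            (fun _ _ => ENNReal.ofReal_add_le) _ _
      _ ≤ _ := (Finset.sum_le_sum fun i _ => hlow i).trans
          (hmain.trans (Finset.sum_le_sum fun i _ => hupp i))
  rw [Finset.sum_sub_distrib, Finset.sum_add_distrib, Finset.sum_const, Finset.card_univ,
    nsmul_eq_mul] at hreal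
  have : (Fintype.card ι : ℝ) * (2 * δ) = η / 2 := by
    rw [hδ_def]
    field_simp
    norm_num
  linarith

/-! ### Complementary slackness -/

theorem LipschitzWith.integrable_of_integrable_norm {E : Type*} [NormedAddCommGroup E]
    [MeasurableSpace E] [OpensMeasurableSpace E] {μ : Measure E} [IsFiniteMeasure μ]
    (hμ : Integrable (fun x => ‖x‖) μ) {g : E → ℝ} (hg : LipschitzWith 1 g) : Integrable g μ := by
  refine ((integrable_const ‖g 0‖).add hμ).mono' hg.continuous.measurable.aestronglyMeasurable
    (.of_forall fun x => ?_)
  have := hg.dist_le_mul x 0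
  rw [NNReal.coe_one, one_mul, dist_zero_right, dist_eq_norm] at this
  have h2 := norm_le_norm_add_norm_sub' (g x) (g 0)
  simp only [Pi.add_apply]
  linarith

theorem dualObjective_eq_integral [IsFiniteMeasure p] [IsFiniteMeasure q]
    (hp : Integrable (fun x => ‖x‖) p) (hq : Integrable (fun x => ‖x‖) q)
    (hγ : γ ∈ transportPlans p q) {g : EuclideanSpace ℝ (Fin n) → ℝ} (hg : LipschitzWith 1 g) :
    dualObjective p q g = ∫ z, (g z.1 - g z.2) ∂γ := by
  have hgm := hg.continuous.measurable
  rw [integral_sub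
    (integrable_comp_fst_of_mem_transportPlans hγ (hg.integrable_of_integrable_norm hp))
    (integrable_comp_snd_of_mem_transportPlans hγ (hg.integrable_of_integrable_norm hq))]
  unfold dualObjective
  congr 1
  · rw [← hγ.1, Measure.fst, integral_map measurable_fst.aemeasurable hgm.aestronglyMeasurable]
  · rw [← hγ.2, Measure.snd, integral_map measurable_snd.aemeasurable hgm.aestronglyMeasurable]

theorem sub_le_norm_sub_of_lipschitzWith_one {E : Type*} [SeminormedAddCommGroup E] {f : E → ℝ}
    (hf : LipschitzWith 1 f) (x y : E) : f x - f y ≤ ‖x - y‖ := by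
  have := hf.dist_le_mul x y
  rw [NNReal.coe_one, one_mul, Real.dist_eq, dist_eq_norm] at this
  exact (le_abs_self _).trans this

/-- An optimal critic decreases by the full distance along almost every pair of an optimal plan. -/
theorem IsOptimalPlan.ae_sub_eq_norm_sub [IsProbabilityMeasure p] [IsProbabilityMeasure q]
    (hp : Integrable (fun x => ‖x‖) p) (hq : Integrable (fun x => ‖x‖) q)
    (hγ : IsOptimalPlan p q γ) {f : EuclideanSpace ℝ (Fin n) → ℝ} (hf : IsOptimalCritic p q f) :
    ∀ᵐ z ∂γ, f z.1 - f z.2 = ‖z.1 - z.2‖ := by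
  have := isProbabilityMeasure_of_mem_transportPlans hγ.1
  have hmono : CyclicallyMonotone γ.support := fun k z σ hz =>
    hγ.sum_dist_le (transportCost_ne_top hp hq hγ.1) σ z hz
  obtain ⟨g, hg, hgS⟩ := exists_lipschitz_of_cyclicallyMonotone hmono
  have hnorm := integrable_norm_sub_of_mem_transportPlans hp hq hγ.1
  have hfint : Integrable (fun z => f z.1 - f z.2) γ :=
    (integrable_comp_fst_of_mem_transportPlans hγ.1 (hf.1.integrable_of_integrable_norm hp)).sub
    (integrable_comp_snd_of_mem_transportPlans hγ.1 (hf.1.integrable_of_integrable_norm hq))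
  have hge : ∫ z, ‖z.1 - z.2‖ ∂γ ≤ ∫ z, (f z.1 - f z.2) ∂γ := by
    have hgae : (fun z => g z.1 - g z.2) =ᵐ[γ] fun z => ‖z.1 - z.2‖ := by
      filter_upwards [Measure.support_mem_ae] with z hz
      rw [hgS z hz, dist_eq_norm]
    rw [← integral_congr_ae hgae, ← dualObjective_eq_integral hp hq hγ.1 hg,
      ← dualObjective_eq_integral hp hq hγ.1 hf.1]
    exact hf.2 hg
  have hle : ∀ z : EuclideanSpace ℝ (Fin n) × EuclideanSpace ℝ (Fin n),
      f z.1 - f z.2 ≤ ‖z.1 - z.2‖ := fun z => sub_le_norm_sub_of_lipschitzWith_one hf.1 _ _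
  exact (integral_eq_iff_of_ae_le hfint hnorm (.of_forall hle)).1
    (le_antisymm (integral_mono hfint hnorm hle) hge)

end Plans

/-! ### The gradient along a segment of maximal decrease -/

/-- The nonnegative difference of the two bounds has a minimum where they touch, so their derivatives
agree there, and the squeezed function has the same derivative. -/
theorem hasFDerivAt_of_squeeze {E : Type*} [NormedAddCommGroup E] [NormedSpace ℝ E]
    {l f u : E → ℝ} {a : E} (hl : DifferentiableAt ℝ l a) (hu : DifferentiableAt ℝ u a)
    (hlf : ∀ w, l w ≤ f w) (hfu : ∀ w, f w ≤ u w) (hla : l a = f a) (hua : f a = u a) :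
    HasFDerivAt f (fderiv ℝ l a) a := by
  have hd : HasFDerivAt (u - l) (fderiv ℝ u a - fderiv ℝ l a) a := hu.hasFDerivAt.sub hl.hasFDerivAt
  have hmin : IsLocalMin (u - l) a := .of_forall fun w => by
    simp only [Pi.sub_apply]
    linarith [hlf w, hfu w]
  rw [hmin.hasFDerivAt_eq_zero hd] at hd
  have hfl : HasFDerivAt (f - l) (0 : E →L[ℝ] ℝ) a := by
    rw [hasFDerivAt_iff_isLittleO] at hd ⊢
    refine (Asymptotics.isBigO_of_le _ fun w => ?_).trans_isLittleO hd
    simp only [Pi.sub_apply, _root_.zero_apply, hla, hua, sub_self, sub_zero]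
    rw [Real.norm_of_nonneg (by linarith [hlf w]),
      Real.norm_of_nonneg (by linarith [hlf w, hfu w])]
    linarith [hfu w]
  simpa using hfl.add hl.hasFDerivAt

section Segment

variable {E : Type*} [NormedAddCommGroup E] [InnerProductSpace ℝ E] {f : E → ℝ} {x y : E}

theorem sub_segment_left (x y : E) (t : ℝ) : x - ((1 - t) • x + t • y) = t • (x - y) := by
  module

theorem segment_sub_right (x y : E) (t : ℝ) : (1 - t) • x + t • y - y = (1 - t) • (x - y) := by
  module

/-- The Lipschitz bounds on the two parts of the segment add up to the equality for the whole. -/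
theorem apply_segment_eq (hf : LipschitzWith 1 f) (hxy : f x - f y = ‖x - y‖) {t : ℝ}
    (ht : t ∈ Set.Icc (0 : ℝ) 1) : f ((1 - t) • x + t • y) = f x - t * ‖x - y‖ := by
  have h1 := sub_le_norm_sub_of_lipschitzWith_one hf x ((1 - t) • x + t • y)
  have h2 := sub_le_norm_sub_of_lipschitzWith_one hf ((1 - t) • x + t • y) y
  rw [sub_segment_left, norm_smul, Real.norm_of_nonneg ht.1] at h1
  rw [segment_sub_right, norm_smul, Real.norm_of_nonneg (sub_nonneg.2 ht.2)] at h2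
  linarith

/-- The bounds `f x - ‖x - ·‖` and `f y + ‖· - y‖` touch `f` at an interior point of the segment, and
both are differentiable there because the point is neither `x` nor `y`. -/
theorem differentiableAt_segment (hf : LipschitzWith 1 f) (hxy : f x - f y = ‖x - y‖) (hne : x ≠ y)
    {t : ℝ} (ht : t ∈ Set.Ioo (0 : ℝ) 1) : DifferentiableAt ℝ f ((1 - t) • x + t • y) := by
  have hsub : x - y ≠ 0 := sub_ne_zero.2 hne
  have hval := apply_segment_eq hf hxy (Set.Ioo_subset_Icc_self ht)
  have hx0 : x - ((1 - t) • x + t • y) ≠ 0 := by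
    rw [sub_segment_left]
    exact smul_ne_zero ht.1.ne' hsub
  have hy0 : (1 - t) • x + t • y - y ≠ 0 := by
    rw [segment_sub_right]
    exact smul_ne_zero (sub_pos.2 ht.2).ne' hsub
  refine (hasFDerivAt_of_squeeze (l := fun w => f x - ‖x - w‖) (u := fun w => f y + ‖w - y‖)
    ?_ ?_ ?_ ?_ ?_ ?_).differentiableAt
  · exact (((differentiableAt_const x).sub differentiableAt_id).norm ℝ hx0).const_sub (f x)
  · exact ((differentiableAt_id.sub (differentiableAt_const y)).norm ℝ hy0).const_add (f y)
  · intro w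
    linarith [sub_le_norm_sub_of_lipschitzWith_one hf x w]
  · intro w
    linarith [sub_le_norm_sub_of_lipschitzWith_one hf w y]
  · rw [hval, sub_segment_left, norm_smul, Real.norm_of_nonneg ht.1.le]
  · rw [hval, segment_sub_right, norm_smul, Real.norm_of_nonneg (sub_pos.2 ht.2).le]
    linarith

/-- Endpoints are included: a derivative within `[0, 1]` of `f` along the segment is unique at every
`t ∈ [0, 1]`. -/
theorem norm_gradient_segment [CompleteSpace E] (hf : LipschitzWith 1 f)
    (hxy : f x - f y = ‖x - y‖) (hne : x ≠ y) {t : ℝ} (ht : t ∈ Set.Icc (0 : ℝ) 1)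
    (hd : DifferentiableAt ℝ f ((1 - t) • x + t • y)) :
    ‖gradient f ((1 - t) • x + t • y)‖ = 1 := by
  rw [gradient, LinearIsometryEquiv.norm_map]
  refine le_antisymm (NNReal.coe_one ▸ norm_fderiv_le_of_lipschitz ℝ hf) ?_
  have hpos : 0 < ‖x - y‖ := norm_pos_iff.2 (sub_ne_zero.2 hne)
  have hline : HasDerivAt (fun s : ℝ => (1 - s) • x + s • y) (y - x) t := by
    have h := (((hasDerivAt_id t).const_sub 1).smul_const x).add ((hasDerivAt_id t).smul_const y)
    convert! h using 1
    module
  have h1 : HasDerivWithinAt (fun s : ℝ => f ((1 - s) • x + s • y))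
      (fderiv ℝ f ((1 - t) • x + t • y) (y - x)) (Set.Icc 0 1) t :=
    (hd.hasFDerivAt.comp_hasDerivAt t hline).hasDerivWithinAt
  have h2 : HasDerivWithinAt (fun s : ℝ => f ((1 - s) • x + s • y)) (-‖x - y‖)
      (Set.Icc 0 1) t := by
    have h : HasDerivAt (fun s : ℝ => f x - s * ‖x - y‖) (-‖x - y‖) t := by
      simpa using ((hasDerivAt_id t).mul_const ‖x - y‖).const_sub (f x)
    exact h.hasDerivWithinAt.congr_of_mem (fun s hs => apply_segment_eq hf hxy hs) ht
  have heq := (uniqueDiffOn_Icc zero_lt_one t ht).eq_deriv _ h1 h2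
  have hop := (fderiv ℝ f ((1 - t) • x + t • y)).le_opNorm (y - x)
  rw [heq, norm_neg, norm_norm, norm_sub_rev y x] at hop
  exact le_of_mul_le_mul_right (by simpa using hop) hpos

end Segment

theorem measurableSet_norm_gradient_eq_one {E : Type*} [NormedAddCommGroup E]
    [InnerProductSpace ℝ E] [CompleteSpace E] [MeasurableSpace E] [BorelSpace E] (f : E → ℝ) :
    MeasurableSet {x | DifferentiableAt ℝ f x → ‖gradient f x‖ = 1} := by
  simp only [gradient, LinearIsometryEquiv.norm_map]
  exact (measurableSet_of_differentiableAt ℝ f).imp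
    (measurableSet_eq_fun (measurable_fderiv ℝ f).norm measurable_const)

/-! ### Gradient norm of an optimal critic -/

theorem mainTheorem3 (n : ℕ) (p_r p_θ : Measure (EuclideanSpace ℝ (Fin n)))
    [IsProbabilityMeasure p_r] [IsProbabilityMeasure p_θ]
    (h_r : Integrable (fun x => ‖x‖) p_r) (h_θ : Integrable (fun x => ‖x‖) p_θ)
    (f : EuclideanSpace ℝ (Fin n) → ℝ) (hf : IsOptimalCritic p_r p_θ f)
    (γ : Measure (EuclideanSpace ℝ (Fin n) × EuclideanSpace ℝ (Fin n)))
    (hγ : IsOptimalPlan p_r p_θ γ) :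
    (∀ᵐ z ∂γ, z.1 ≠ z.2 →
      (∀ t ∈ Set.Ioo (0 : ℝ) 1,
        DifferentiableAt ℝ f ((1 - t) • z.1 + t • z.2) ∧
          ‖gradient f ((1 - t) • z.1 + t • z.2)‖ = 1) ∧
      (∀ t ∈ Set.Icc (0 : ℝ) 1,
        DifferentiableAt ℝ f ((1 - t) • z.1 + t • z.2) →
          ‖gradient f ((1 - t) • z.1 + t • z.2)‖ = 1)) ∧
    (γ {z | z.1 = z.2} = 0 →
      (∀ᵐ x ∂p_r, DifferentiableAt ℝ f x → ‖gradient f x‖ = 1) ∧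
      (∀ᵐ y ∂p_θ, DifferentiableAt ℝ f y → ‖gradient f y‖ = 1)) := by
  have hae := hγ.ae_sub_eq_norm_sub h_r h_θ hf
  refine ⟨?_, fun hdiag => ?_⟩
  · filter_upwards [hae] with z hz hne
    refine ⟨fun t ht => ?_, fun t ht hd => norm_gradient_segment hf.1 hz hne ht hd⟩
    have hd := differentiableAt_segment hf.1 hz hne ht
    exact ⟨hd, norm_gradient_segment hf.1 hz hne (Set.Ioo_subset_Icc_self ht) hd⟩
  have hne : ∀ᵐ z ∂γ, z.1 ≠ z.2 := by
    rw [ae_iff]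
    simpa using hdiag
  constructor
  · rw [← hγ.1.1, Measure.fst, ae_map_iff measurable_fst.aemeasurable
      (measurableSet_norm_gradient_eq_one f)]
    filter_upwards [hae, hne] with z hz hzne
    simpa using norm_gradient_segment hf.1 hz hzne (t := 0) (by simp)
  · rw [← hγ.1.2, Measure.snd, ae_map_iff measurable_snd.aemeasurable
      (measurableSet_norm_gradient_eq_one f)]
    filter_upwards [hae, hne] with z hz hzne
    simpa using norm_gradient_segment hf.1 hz hzne (t := 1) (by simp)
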